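/- Let $1<r\le 2$, $r\le p<\infty$, $1<q\le\infty$. Let $(\phi_n)_{n\ge1}$ be the real trigonometric system on $[-\pi,\pi]$ (with Lebesgue measure), i.e. $\phi_1=\frac1{\sqrt{2\pi}}$, $\phi_{2k}(x)=\frac{\cos(kx)}{\sqrt\pi}$, $\phi_{2k+1}(x)=\frac{\sin(kx)}{\sqrt\pi}$ for $k\ge 1$. All spaces are real. For $t\in[1,\infty]$ let $t'$ be the conjugate exponent, $\frac1t+\frac1{t'}=1$, and for $a,b\in[1,\infty]$ put $s_{ab}=\infty$ if $a\le b$, $s_{ab}=\frac{ab}{a-b}$ if $b<a<\infty$, and $s_{ab}=b$ if $b<a=\infty$. Write $s=s_{r'q}$; then $s>1$, so $s'<\infty$. The Fourier operator $\mathcal F(f)=\big(\int_{-\pi}^{\pi} f\phi_n\,dx\big)_{n\ge1}$ is a well-defined continuous linear operator $L^r[-\pi,\pi]\to\ell^{r'}$. Let $i:L^p[-\pi,\pi]\to L^r[-\pi,\pi]$ be the inclusion, and for $g\in\ell^{s}$ let $M_g:\ell^{r'}\to\ell^q$, $M_g(x)=(g_kx_k)_k$, be the multiplication operator. Let $T:L^p[-\pi,\pi]\to\ell^q$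 be a continuous linear operator. The following are equivalent: (a) there exists $g\in\ell^{s}$ such that $T=M_g\circ\mathcal F\circ i$; (b) $T(\phi_n)_k=0$ for all $k\ne n$, and $\big(T(\phi_k)_k\big)_k\in\ell^{s}$; (c) there is a constant $C>0$ such that $$\sum_{k=1}^n\sum_{j=1}^m r_{kj}\,T(\phi_j)_k\le C\Big(\sum_{k=1}^{\min\{n,m\}}|r_{kk}|^{s'}\Big)^{1/s'}$$ for all $n,m\in\mathbb N$ and all real $(r_{kj})$ with $\sup_{k,j}|r_{kj}|\le1$. Moreover, if $r'\le q$, then (a)–(c) are also equivalent to: (d) there is a constant $C>0$ such that, for all $n,m\in\mathbb N$ and all real $(r_j)$ with $\sup_j|r_j|\le 1$, $$\sum_{j=1}^m r_j\,T(\phi_j)_n\le C\,|r_n|\ \text{ if } n\le m,\qquad \sum_{j=1}^m r_j\,T(\phi_j)_n\le 0\ \text{ if } n>m.$$ -/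

import Mathlib

open MeasureTheory
open scoped ENNReal

noncomputable section

namespace FourierFactor

/-- Lebesgue measure on the interval `[-π, π]`. -/
abbrev circMeasure : Measure ℝ := volume.restrict (Set.Icc (-Real.pi) Real.pi)

/-- The real space `L^p[-π, π]`. -/
abbrev LpT (p : ℝ≥0∞) : Type := Lp ℝ p circMeasure

/-- The space `ℓ^p` of real sequences. Sequences are indexed from `0`: the term of index `n` here is
the term of index `n + 1` in the usual numbering from `1`. -/
abbrev ellp (p : ℝ≥0∞) : Type := lp (fun _ : ℕ => ℝ) p

instance fact_one_le_conjExponent (r : ℝ≥0∞) : Fact (1 ≤ ENNReal.conjExponent r) :=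
  ⟨by simp [ENNReal.conjExponent]⟩

/-- The exponent `s_{pq}`, for which `ℓ^{s_{pq}}` is the space of multipliers from `ℓ^p`
to `ℓ^q`. -/
def sExp (p q : ℝ≥0∞) : ℝ≥0∞ :=
  if p ≤ q then ∞ else if p = ∞ then q else p * q / (p - q)

/-- The real trigonometric system
`1/√(2π), cos x/√π, sin x/√π, cos 2x/√π, sin 2x/√π, …`, indexed from `0`. -/
def trig (n : ℕ) (x : ℝ) : ℝ :=
  if n = 0 then 1 / Real.sqrt (2 * Real.pi)
  else if Odd n then Real.cos (((n + 1) / 2 : ℕ) * x) / Real.sqrt Real.pi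
  else Real.sin ((n / 2 : ℕ) * x) / Real.sqrt Real.pi

theorem continuous_trig (n : ℕ) : Continuous (trig n) := by
  unfold trig
  split_ifs <;> fun_prop

theorem memLp_trig (p : ℝ≥0∞) (n : ℕ) : MemLp (trig n) p circMeasure := by
  obtain ⟨C, hC⟩ := isCompact_Icc.exists_bound_of_continuousOn
    (continuous_trig n).continuousOn (s := Set.Icc (-Real.pi) Real.pi)
  refine MemLp.of_bound (continuous_trig n).aestronglyMeasurable C ?_
  exact (ae_restrict_iff' measurableSet_Icc).2 (Filter.Eventually.of_forall hC)

/-- The `n`-th trigonometric function as an element of `L^p[-π, π]`. -/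
def trigLp (p : ℝ≥0∞) (n : ℕ) : LpT p := (memLp_trig p n).toLp (trig n)

/-- The `n`-th Fourier coefficient `∫ f φ_n` over `[-π, π]`. -/
def coeff (f : ℝ → ℝ) (n : ℕ) : ℝ := ∫ x in Set.Icc (-Real.pi) Real.pi, f x * trig n x

/-- The inclusion `L^p[-π, π] → L^r[-π, π]` for `r ≤ p`. -/
def incl {r p : ℝ≥0∞} (h : r ≤ p) : LpT p →ₗ[ℝ] LpT r where
  toFun f := ((Lp.memLp f).mono_exponent h).toLp f
  map_add' f g := by
    rw [← MemLp.toLp_add]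
    exact (MemLp.toLp_eq_toLp_iff _ _).2 (Lp.coeFn_add f g)
  map_smul' c f := by
    rw [RingHom.id_apply, ← MemLp.toLp_const_smul]
    exact (MemLp.toLp_eq_toLp_iff _ _).2 (Lp.coeFn_smul c f)

theorem memℓp_mul {p q : ℝ≥0∞} (hq : 1 ≤ q) {g x : ℕ → ℝ}
    (hg : Memℓp g (sExp p q)) (hx : Memℓp x p) : Memℓp (fun i => g i * x i) q := by
  have key : ∀ t : ℝ≥0∞, ENNReal.HolderTriple (sExp p q) p t →
      Memℓp (fun i => g i * x i) t := by
    intro t _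
    exact Memℓp.holder t hg hx (fun _ => ContinuousLinearMap.mul ℝ ℝ) (K := 1)
      (fun _ => ContinuousLinearMap.opNorm_mul_le ℝ ℝ)
  by_cases h : p ≤ q
  · have hs : sExp p q = ∞ := by simp [sExp, h]
    exact (key p (by rw [hs]; infer_instance)).of_exponent_ge h
  · refine key q ⟨?_⟩
    by_cases hp : p = ∞
    · simp [sExp, hp, show q ≠ ∞ by rintro rfl; simp at h]
    · have hlt : q < p := not_le.1 h
      have hq0 : q ≠ 0 := (zero_lt_one.trans_le hq).ne'
      have hqt : q ≠ ∞ := hlt.ne_top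
      have hp0 : p ≠ 0 := (bot_le.trans_lt hlt).ne'
      simp only [sExp, h, hp, if_false]
      rw [ENNReal.inv_div (Or.inr (ENNReal.mul_ne_top hp hqt)) (Or.inr (mul_ne_zero hp0 hq0))]
      rw [← ENNReal.toReal_eq_toReal_iff' (by
          simp [ENNReal.add_eq_top, ENNReal.div_eq_top, hp0, hq0, hp]) (by simpa using hq0)]
      rw [ENNReal.toReal_add (by simp [ENNReal.div_eq_top, hp0, hq0, hp]) (by simpa using hp0)]
      rw [ENNReal.toReal_div, ENNReal.toReal_sub_of_le hlt.le hp, ENNReal.toReal_mul,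
        ENNReal.toReal_inv, ENNReal.toReal_inv]
      have h1 := (ENNReal.toReal_pos hp0 hp).ne'
      have h2 := (ENNReal.toReal_pos hq0 hqt).ne'
      field_simp
      ring

/-- The multiplication operator `M_g : ℓ^p → ℓ^q`, `x ↦ (g_i x_i)_i`, for `g ∈ ℓ^{s_{pq}}`. -/
def mulOp {p q : ℝ≥0∞} [hq : Fact (1 ≤ q)] (g : ellp (sExp p q)) : ellp p →ₗ[ℝ] ellp q where
  toFun x := ⟨fun i => g i * x i, memℓp_mul hq.out (lp.memℓp g) (lp.memℓp x)⟩
  map_add' x y := by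
    ext i
    exact mul_add _ _ _
  map_smul' c x := by
    ext i
    simp [mul_left_comm]

end FourierFactor

end

namespace FourierFactor


/-! Everything is read off the matrix of coordinates `T (φ_j)_k`. Biorthogonality of the
trigonometric system (`coeff_trig`) shows that `M_g ∘ F ∘ i` has a diagonal matrix with diagonal
`g`. Conversely, if the matrix of `T` is diagonal, each coordinate of `T` and the matching multiple
of the Fourier coefficient are continuous functionals agreeing on all `φ_n`. They coincide because
trigonometric polynomials are dense in `L^p` for `p < ∞` (`span_trigLp_closure_eq_top`). This gives
(a) ⇔ (b) in `exists_factorization_iff`.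

The domination conditions are about matrices alone. Testing with a single entry `±1` off the
diagonal makes the right side vanish and kills that entry; testing with diagonal matrices says that
the diagonal is a bounded functional for the `ℓ^{s'}`-norm, that is, lies in `ℓ^s`
(`exists_sum_mul_le_iff_memℓp`). If `r' ≤ q` then `s = ∞`, and testing single rows suffices.

The existence of the Fourier operator is Hausdorff–Young. Membership in `ℓ^{r'}` comes from real
interpolation between the trivial bound `L^1 → ℓ^∞` and Bessel's inequality (`sum_coeff_rpow_le`);
continuity then comes from the closed graph theorem, so no norm inequality is needed. -/

/-! ### Orthonormality of the trigonometric system. -/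

theorem setIntegral_cos_int_mul (k : ℤ) :
    ∫ x in Set.Icc (-Real.pi) Real.pi, Real.cos (k * x) = if k = 0 then 2 * Real.pi else 0 := by
  rw [integral_Icc_eq_integral_Ioc, ← intervalIntegral.integral_of_le (by linarith [Real.pi_pos])]
  split_ifs with h
  · subst h
    simp
    ring
  · have hk : (k : ℝ) ≠ 0 := by exact_mod_cast h
    rw [intervalIntegral.integral_comp_mul_left (fun x => Real.cos x) hk, integral_cos]
    simp [Real.sin_int_mul_pi]

theorem setIntegral_sin_int_mul (k : ℤ) :
    ∫ x in Set.Icc (-Real.pi) Real.pi, Real.sin (k * x) = 0 := by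
  rw [integral_Icc_eq_integral_Ioc, ← intervalIntegral.integral_of_le (by linarith [Real.pi_pos])]
  rcases eq_or_ne k 0 with rfl | h
  · simp
  · have hk : (k : ℝ) ≠ 0 := by exact_mod_cast h
    rw [intervalIntegral.integral_comp_mul_left (fun x => Real.sin x) hk, integral_sin]
    simp

theorem integrableOn_cos (k : ℤ) :
    IntegrableOn (fun x : ℝ => Real.cos (k * x)) (Set.Icc (-Real.pi) Real.pi) :=
  Continuous.integrableOn_Icc (by fun_prop)

theorem integrableOn_sin (k : ℤ) :
    IntegrableOn (fun x : ℝ => Real.sin (k * x)) (Set.Icc (-Real.pi) Real.pi) :=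
  Continuous.integrableOn_Icc (by fun_prop)

theorem setIntegral_cos_mul_cos (k l : ℤ) :
    ∫ x in Set.Icc (-Real.pi) Real.pi, Real.cos (k * x) * Real.cos (l * x) =
      ((if k = l then 2 * Real.pi else 0) + if k = -l then 2 * Real.pi else 0) / 2 := by
  have h : ∀ x : ℝ, Real.cos (k * x) * Real.cos (l * x) =
      (Real.cos ((k - l : ℤ) * x) + Real.cos ((k + l : ℤ) * x)) / 2 := by
    intro x
    push_cast
    rw [sub_mul, add_mul, Real.cos_sub, Real.cos_add]
    ring
  simp_rw [h]
  rw [integral_div, integral_add (integrableOn_cos _) (integrableOn_cos _),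
    setIntegral_cos_int_mul, setIntegral_cos_int_mul]
  simp only [sub_eq_zero, add_eq_zero_iff_eq_neg]

theorem setIntegral_sin_mul_sin (k l : ℤ) :
    ∫ x in Set.Icc (-Real.pi) Real.pi, Real.sin (k * x) * Real.sin (l * x) =
      ((if k = l then 2 * Real.pi else 0) - if k = -l then 2 * Real.pi else 0) / 2 := by
  have h : ∀ x : ℝ, Real.sin (k * x) * Real.sin (l * x) =
      (Real.cos ((k - l : ℤ) * x) - Real.cos ((k + l : ℤ) * x)) / 2 := by
    intro x
    push_cast
    rw [sub_mul, add_mul, Real.cos_sub, Real.cos_add]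
    ring
  simp_rw [h]
  rw [integral_div, integral_sub (integrableOn_cos _) (integrableOn_cos _),
    setIntegral_cos_int_mul, setIntegral_cos_int_mul]
  simp only [sub_eq_zero, add_eq_zero_iff_eq_neg]

theorem setIntegral_sin_mul_cos (k l : ℤ) :
    ∫ x in Set.Icc (-Real.pi) Real.pi, Real.sin (k * x) * Real.cos (l * x) = 0 := by
  have h : ∀ x : ℝ, Real.sin (k * x) * Real.cos (l * x) =
      (Real.sin ((k - l : ℤ) * x) + Real.sin ((k + l : ℤ) * x)) / 2 := by
    intro x
    push_cast
    rw [sub_mul, add_mul, Real.sin_sub, Real.sin_add]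
    ring
  simp_rw [h]
  rw [integral_div, integral_add (integrableOn_sin _) (integrableOn_sin _),
    setIntegral_sin_int_mul, setIntegral_sin_int_mul]
  simp

theorem setIntegral_cos_mul_sin (k l : ℤ) :
    ∫ x in Set.Icc (-Real.pi) Real.pi, Real.cos (k * x) * Real.sin (l * x) = 0 := by
  simp_rw [mul_comm (Real.cos _)]
  exact setIntegral_sin_mul_cos l k

/-- Writing the constant as a cosine of frequency zero lets the cosine product formula cover it: at
`k = l = 0` both conditions `k = l` and `k = -l` hold, and the integral doubles to `2π`, as the
normalization requires. -/
theorem trig_zero (x : ℝ) :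
    trig 0 x = (1 / Real.sqrt (2 * Real.pi)) * Real.cos ((0 : ℤ) * x) := by
  simp [trig]

theorem trig_odd (k : ℕ) (x : ℝ) :
    trig (2 * k + 1) x = (1 / Real.sqrt Real.pi) * Real.cos ((k + 1 : ℤ) * x) := by
  have h : (2 * k + 1 + 1) / 2 = k + 1 := by omega
  simp [trig, h, div_eq_inv_mul]

theorem trig_even (k : ℕ) (x : ℝ) :
    trig (2 * k + 2) x = (1 / Real.sqrt Real.pi) * Real.sin ((k + 1 : ℤ) * x) := by
  have h : (2 * k + 2) / 2 = k + 1 := by omega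
  have h' : ¬ Odd (2 * k + 2) := by
    rw [Nat.not_odd_iff_even]
    exact ⟨k + 1, by ring⟩
  simp [trig, h, h', div_eq_inv_mul]

theorem index_cases (n : ℕ) : n = 0 ∨ (∃ k, n = 2 * k + 1) ∨ ∃ k, n = 2 * k + 2 := by
  rcases Nat.even_or_odd' n with ⟨k, rfl | rfl⟩
  · rcases k with _ | k
    · simp
    · exact Or.inr (Or.inr ⟨k, by ring⟩)
  · exact Or.inr (Or.inl ⟨k, rfl⟩)

/-- The Fourier coefficients of the trigonometric functions. -/
theorem coeff_trig (n m : ℕ) : coeff (trig n) m = if n = m then 1 else 0 := by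
  have hπ := Real.pi_pos
  have h1 : Real.sqrt Real.pi * Real.sqrt Real.pi = Real.pi := Real.mul_self_sqrt hπ.le
  have h2 : Real.sqrt (2 * Real.pi) * Real.sqrt (2 * Real.pi) = 2 * Real.pi :=
    Real.mul_self_sqrt (by positivity)
  have key : ∀ (a b : ℝ) (f g : ℝ → ℝ),
      ∫ x in Set.Icc (-Real.pi) Real.pi, a * f x * (b * g x) =
        a * b * ∫ x in Set.Icc (-Real.pi) Real.pi, f x * g x := by
    intro a b f g
    rw [← integral_const_mul]
    congr 1
    ext x
    ring
  unfold coeff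
  rcases index_cases n with rfl | ⟨k, rfl⟩ | ⟨k, rfl⟩ <;>
  rcases index_cases m with rfl | ⟨l, rfl⟩ | ⟨l, rfl⟩ <;>
  simp only [trig_zero, trig_odd, trig_even] <;>
  rw [key] <;>
  simp only [setIntegral_sin_mul_cos, setIntegral_cos_mul_sin, setIntegral_cos_mul_cos,
    setIntegral_sin_mul_sin]
  · simp only [neg_zero, if_true, div_mul_div_comm, h2]
    field_simp
    ring
  · rw [if_neg (by omega), if_neg (by omega), if_neg (by omega)]
    simp
  · rw [if_neg (by omega)]
    simp
  · rw [if_neg (by omega), if_neg (by omega), if_neg (by omega)]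
    simp
  · rw [if_neg (show ¬ ((k + 1 : ℤ) = -(l + 1)) by omega)]
    by_cases h : k = l
    · subst h
      simp only [if_true, div_mul_div_comm, h1]
      field_simp
      ring
    · rw [if_neg (by omega), if_neg (by omega)]
      simp
  · rw [if_neg (by omega)]
    simp
  · rw [if_neg (by omega)]
    simp
  · rw [if_neg (by omega)]
    simp
  · rw [if_neg (show ¬ ((k + 1 : ℤ) = -(l + 1)) by omega)]
    by_cases h : k = l
    · subst h
      simp only [if_true, div_mul_div_comm, h1]
      field_simp
      ring
    · rw [if_neg (by omega), if_neg (by omega)]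
      simp

/-! ### Elementary properties of Fourier coefficients and Bessel's inequality. -/

theorem abs_trig_le_one (n : ℕ) (x : ℝ) : |trig n x| ≤ 1 := by
  have h1 : 1 / Real.sqrt Real.pi ≤ 1 := by
    rw [div_le_one (Real.sqrt_pos.2 Real.pi_pos), Real.one_le_sqrt]
    linarith [Real.pi_gt_three]
  have h2 : 1 / Real.sqrt (2 * Real.pi) ≤ 1 := by
    rw [div_le_one (Real.sqrt_pos.2 (by positivity)), Real.one_le_sqrt]
    linarith [Real.pi_gt_three]
  rcases index_cases n with rfl | ⟨k, rfl⟩ | ⟨k, rfl⟩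
  · rw [trig_zero, abs_mul, abs_of_nonneg (by positivity)]
    exact mul_le_one₀ h2 (abs_nonneg _) (Real.abs_cos_le_one _)
  · rw [trig_odd, abs_mul, abs_of_nonneg (by positivity)]
    exact mul_le_one₀ h1 (abs_nonneg _) (Real.abs_cos_le_one _)
  · rw [trig_even, abs_mul, abs_of_nonneg (by positivity)]
    exact mul_le_one₀ h1 (abs_nonneg _) (Real.abs_sin_le_one _)

theorem inner_trigLp (n : ℕ) (f : LpT 2) : inner ℝ (trigLp 2 n) f = coeff f n := by
  rw [L2.inner_def]
  refine integral_congr_ae ?_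
  filter_upwards [(memLp_trig 2 n).coeFn_toLp] with x hx
  simp only [trigLp, hx, RCLike.inner_apply, conj_trivial]

theorem coeff_congr_ae {f g : ℝ → ℝ} (h : f =ᵐ[circMeasure] g) (n : ℕ) :
    coeff f n = coeff g n := by
  refine integral_congr_ae ?_
  filter_upwards [h] with x hx
  rw [hx]

theorem orthonormal_trigLp : Orthonormal ℝ (trigLp 2) := by
  rw [orthonormal_iff_ite]
  intro i j
  rw [inner_trigLp, trigLp, coeff_congr_ae (memLp_trig 2 j).coeFn_toLp, coeff_trig]
  simp only [eq_comm]

/-- Bessel's inequality for the trigonometric system. -/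
theorem sum_coeff_sq_le {f : ℝ → ℝ} (hf : MemLp f 2 circMeasure) (s : Finset ℕ) :
    ∑ n ∈ s, coeff f n ^ 2 ≤ ∫ x, f x ^ 2 ∂circMeasure := by
  have h := orthonormal_trigLp.sum_inner_products_le (hf.toLp f) (s := s)
  have h2 : ‖hf.toLp f‖ ^ 2 = ∫ x, f x ^ 2 ∂circMeasure := by
    rw [← real_inner_self_eq_norm_sq, L2.inner_def]
    refine integral_congr_ae ?_
    filter_upwards [hf.coeFn_toLp] with x hx
    simp [hx, sq]
  simp_rw [inner_trigLp, coeff_congr_ae hf.coeFn_toLp, Real.norm_eq_abs, sq_abs] at h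
  rwa [h2] at h

theorem integrable_mul_trig {f : ℝ → ℝ} (hf : Integrable f circMeasure) (n : ℕ) :
    Integrable (fun x => f x * trig n x) circMeasure :=
  hf.mul_bdd (c := 1) (continuous_trig n).aestronglyMeasurable
    (Filter.Eventually.of_forall (abs_trig_le_one n))

theorem coeff_add {f g : ℝ → ℝ} (hf : Integrable f circMeasure) (hg : Integrable g circMeasure)
    (n : ℕ) : coeff (fun x => f x + g x) n = coeff f n + coeff g n := by
  simp only [coeff, add_mul]
  exact integral_add (integrable_mul_trig hf n) (integrable_mul_trig hg n)

theorem coeff_const_mul (c : ℝ) (f : ℝ → ℝ) (n : ℕ) :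
    coeff (fun x => c * f x) n = c * coeff f n := by
  simp only [coeff, mul_assoc]
  exact integral_const_mul _ _

theorem abs_coeff_le {f : ℝ → ℝ} (hf : Integrable f circMeasure) (n : ℕ) :
    |coeff f n| ≤ ∫ x, |f x| ∂circMeasure := by
  refine (abs_integral_le_integral_abs).trans
    (integral_mono (integrable_mul_trig hf n).abs hf.abs fun x => ?_)
  simp only [abs_mul]
  exact mul_le_of_le_one_right (abs_nonneg _) (abs_trig_le_one n x)


/-! ### Density of trigonometric polynomials in `L^p`. -/

theorem memLp_of_continuous (p : ℝ≥0∞) {f : ℝ → ℝ} (hf : Continuous f) :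
    MemLp f p circMeasure := by
  obtain ⟨C, hC⟩ := isCompact_Icc.exists_bound_of_continuousOn
    hf.continuousOn (s := Set.Icc (-Real.pi) Real.pi)
  refine MemLp.of_bound hf.aestronglyMeasurable C ?_
  exact (ae_restrict_iff' measurableSet_Icc).2 (Filter.Eventually.of_forall hC)

/-- The class in `L^p[-π, π]` of a continuous function on the line. -/
noncomputable def contToLp (p : ℝ≥0∞) : {f : ℝ → ℝ // Continuous f} → LpT p :=
  fun f => (memLp_of_continuous p f.2).toLp f.1

theorem contToLp_mem_span_of_eq (p : ℝ≥0∞) (f : {f : ℝ → ℝ // Continuous f}) (c : ℝ) (n : ℕ)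
    (h : ∀ x, f.1 x = c * trig n x) :
    contToLp p f ∈ Submodule.span ℝ (Set.range (trigLp p)) := by
  have : contToLp p f = c • trigLp p n := by
    rw [contToLp, trigLp, ← MemLp.toLp_const_smul]
    refine (MemLp.toLp_eq_toLp_iff _ _).2 (Filter.Eventually.of_forall fun x => ?_)
    simp [h]
  rw [this]
  exact Submodule.smul_mem _ _ (Submodule.subset_span ⟨n, rfl⟩)

theorem cos_mem_span (p : ℝ≥0∞) (k : ℤ) :
    contToLp p ⟨fun x => Real.cos (k * x), by fun_prop⟩ ∈
      Submodule.span ℝ (Set.range (trigLp p)) := by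
  have hπ : Real.sqrt Real.pi ≠ 0 := (Real.sqrt_pos.2 Real.pi_pos).ne'
  have h2π : Real.sqrt (2 * Real.pi) ≠ 0 := (Real.sqrt_pos.2 (by positivity)).ne'
  rcases lt_trichotomy k 0 with hk | rfl | hk
  · obtain ⟨j, hj⟩ : ∃ j : ℕ, k = -(j + 1 : ℤ) := ⟨(-k - 1).toNat, by omega⟩
    refine contToLp_mem_span_of_eq p _ (Real.sqrt Real.pi) (2 * j + 1) fun x => ?_
    rw [trig_odd, ← mul_assoc, mul_one_div_cancel hπ, one_mul, ← Real.cos_neg, hj, Int.cast_neg,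
      ← neg_mul]
  · refine contToLp_mem_span_of_eq p _ (Real.sqrt (2 * Real.pi)) 0 fun x => ?_
    rw [trig_zero, ← mul_assoc, mul_one_div_cancel h2π, one_mul]
  · obtain ⟨j, hj⟩ : ∃ j : ℕ, k = (j + 1 : ℤ) := ⟨(k - 1).toNat, by omega⟩
    refine contToLp_mem_span_of_eq p _ (Real.sqrt Real.pi) (2 * j + 1) fun x => ?_
    rw [trig_odd, ← mul_assoc, mul_one_div_cancel hπ, one_mul, hj]

theorem sin_mem_span (p : ℝ≥0∞) (k : ℤ) :
    contToLp p ⟨fun x => Real.sin (k * x), by fun_prop⟩ ∈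
      Submodule.span ℝ (Set.range (trigLp p)) := by
  have hπ : Real.sqrt Real.pi ≠ 0 := (Real.sqrt_pos.2 Real.pi_pos).ne'
  rcases lt_trichotomy k 0 with hk | rfl | hk
  · obtain ⟨j, hj⟩ : ∃ j : ℕ, k = -(j + 1 : ℤ) := ⟨(-k - 1).toNat, by omega⟩
    refine contToLp_mem_span_of_eq p _ (-Real.sqrt Real.pi) (2 * j + 2) fun x => ?_
    rw [trig_even, ← mul_assoc, neg_mul, mul_one_div_cancel hπ, neg_one_mul, ← Real.sin_neg, hj,
      Int.cast_neg, ← neg_mul]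
  · refine contToLp_mem_span_of_eq p _ 0 0 fun x => ?_
    simp
  · obtain ⟨j, hj⟩ : ∃ j : ℕ, k = (j + 1 : ℤ) := ⟨(k - 1).toNat, by omega⟩
    refine contToLp_mem_span_of_eq p _ (Real.sqrt Real.pi) (2 * j + 2) fun x => ?_
    rw [trig_even, ← mul_assoc, mul_one_div_cancel hπ, one_mul, hj]

/-- The real part of a continuous function on the circle, as an element of `L^p[-π, π]`. -/
noncomputable def circleToLp (p : ℝ≥0∞) [Fact (1 ≤ p)] [Fact (0 < 2 * Real.pi)] :
    C(AddCircle (2 * Real.pi), ℂ) →L[ℝ] LpT p :=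
  LinearMap.mkContinuous
    { toFun := fun g => contToLp p ⟨fun x => (g (x : AddCircle (2 * Real.pi))).re,
        Complex.continuous_re.comp (g.continuous.comp (AddCircle.continuous_mk' _))⟩
      map_add' := fun f g => by
        simp only [contToLp]
        rw [← MemLp.toLp_add]
        exact (MemLp.toLp_eq_toLp_iff _ _).2 (Filter.Eventually.of_forall fun x => by simp)
      map_smul' := fun c f => by
        simp only [contToLp]
        rw [RingHom.id_apply, ← MemLp.toLp_const_smul]
        exact (MemLp.toLp_eq_toLp_iff _ _).2 (Filter.Eventually.of_forall fun x => by simp) }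
    (measureUnivNNReal circMeasure ^ p.toReal⁻¹) fun g => by
      refine Lp.norm_le_of_ae_bound (norm_nonneg g) ?_
      simp only [LinearMap.coe_mk, AddHom.coe_mk, contToLp]
      filter_upwards [MemLp.coeFn_toLp (memLp_of_continuous p (Complex.continuous_re.comp
        (g.continuous.comp (AddCircle.continuous_mk' (2 * Real.pi)))))] with x hx
      erw [hx]
      exact (Complex.abs_re_le_norm _).trans (g.norm_coe_le_norm _)

theorem circleToLp_apply (p : ℝ≥0∞) [Fact (1 ≤ p)] [Fact (0 < 2 * Real.pi)]
    (g : C(AddCircle (2 * Real.pi), ℂ)) :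
    circleToLp p g = contToLp p ⟨fun x => (g (x : AddCircle (2 * Real.pi))).re,
        Complex.continuous_re.comp (g.continuous.comp (AddCircle.continuous_mk' _))⟩ := rfl

theorem coeFn_circleToLp (p : ℝ≥0∞) [Fact (1 ≤ p)] [Fact (0 < 2 * Real.pi)]
    (g : C(AddCircle (2 * Real.pi), ℂ)) :
    circleToLp p g =ᵐ[circMeasure] fun x => (g (x : AddCircle (2 * Real.pi))).re := by
  rw [circleToLp_apply]
  exact MemLp.coeFn_toLp _

/-- `Re (c e^{ikx}) = Re c · cos kx - Im c · sin kx`. -/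
theorem circleToLp_fourier_mem (p : ℝ≥0∞) [Fact (1 ≤ p)] [Fact (0 < 2 * Real.pi)] (k : ℤ)
    (c : ℂ) : circleToLp p (c • fourier k) ∈ Submodule.span ℝ (Set.range (trigLp p)) := by
  have : circleToLp p (c • fourier k) =
      c.re • contToLp p ⟨fun x => Real.cos (k * x), by fun_prop⟩ -
      c.im • contToLp p ⟨fun x => Real.sin (k * x), by fun_prop⟩ := by
    rw [circleToLp_apply]
    simp only [contToLp]
    rw [← MemLp.toLp_const_smul, ← MemLp.toLp_const_smul, ← MemLp.toLp_sub]
    refine (MemLp.toLp_eq_toLp_iff _ _).2 (Filter.Eventually.of_forall fun x => ?_)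
    have hk : 2 * (Real.pi : ℂ) * Complex.I * k * x / ((2 * Real.pi : ℝ) : ℂ) =
        ((k * x : ℝ) : ℂ) * Complex.I := by
      have : (Real.pi : ℂ) ≠ 0 := by exact_mod_cast Real.pi_ne_zero
      push_cast
      field_simp
    simp only [ContinuousMap.smul_apply, smul_eq_mul, Pi.sub_apply, Pi.smul_apply,
      Complex.mul_re, fourier_coe_apply, hk, Complex.exp_ofReal_mul_I_re,
      Complex.exp_ofReal_mul_I_im]
  rw [this]
  exact Submodule.sub_mem _ (Submodule.smul_mem _ _ (cos_mem_span p k))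
    (Submodule.smul_mem _ _ (sin_mem_span p k))

theorem circleToLp_mem_closure (p : ℝ≥0∞) [Fact (1 ≤ p)] [Fact (0 < 2 * Real.pi)]
    (g : C(AddCircle (2 * Real.pi), ℂ)) :
    circleToLp p g ∈ (Submodule.span ℝ (Set.range (trigLp p))).topologicalClosure := by
  have hg : g ∈ (Submodule.span ℂ
      (Set.range (@fourier (2 * Real.pi)))).topologicalClosure := by
    rw [span_fourier_closure_eq_top]
    trivial
  refine map_mem_closure (circleToLp p).continuous hg fun h hh => ?_
  -- The span is complex but `circleToLp` is only real linear; carrying an arbitrary complex factor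
  -- through the induction absorbs the scalars.
  suffices H : ∀ c : ℂ, circleToLp p (c • h) ∈ Submodule.span ℝ (Set.range (trigLp p)) by
    simpa using H 1
  refine Submodule.span_induction (p := fun h _ => ∀ c : ℂ, circleToLp p (c • h) ∈
    Submodule.span ℝ (Set.range (trigLp p))) ?_ ?_ ?_ ?_ hh
  · rintro _ ⟨k, rfl⟩ c
    exact circleToLp_fourier_mem p k c
  · intro c
    simp
  · intro x y _ _ hx hy c
    rw [smul_add, map_add]
    exact Submodule.add_mem _ (hx c) (hy c)
  · intro a x _ hx c
    rw [smul_smul]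
    exact hx _

/-- Trigonometric polynomials are dense in `L^p[-π, π]` for `p < ∞`. -/
theorem span_trigLp_closure_eq_top (p : ℝ≥0∞) [Fact (1 ≤ p)] (hp : p ≠ ∞) :
    (Submodule.span ℝ (Set.range (trigLp p))).topologicalClosure = ⊤ := by
  have hT : Fact (0 < 2 * Real.pi) := ⟨Real.two_pi_pos⟩
  rw [eq_top_iff]
  intro f _
  have hcirc : circMeasure = volume.restrict (Set.Ioc (-Real.pi) (-Real.pi + 2 * Real.pi)) := by
    rw [show -Real.pi + 2 * Real.pi = Real.pi by ring]
    exact (Measure.restrict_congr_set Ioc_ae_eq_Icc).symm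
  have mp : MeasurePreserving (fun x : ℝ => (x : AddCircle (2 * Real.pi))) circMeasure volume := by
    rw [hcirc]
    exact AddCircle.measurePreserving_mk (2 * Real.pi) (-Real.pi)
  have hf : MemLp (fun x : ℝ => (f x : ℂ)) p
      (volume.restrict (Set.Ioc (-Real.pi) (-Real.pi + 2 * Real.pi))) := by
    rw [← hcirc]
    exact (Lp.memLp f).ofReal
  -- Continuous approximation is done on the circle, where the approximants are automatically
  -- periodic. Taking real parts does not increase the error.
  set G := AddCircle.liftIoc (2 * Real.pi) (-Real.pi) (fun x : ℝ => (f x : ℂ))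
  have hGf : ∀ᵐ x : ℝ ∂circMeasure, G (x : AddCircle (2 * Real.pi)) = (f x : ℂ) := by
    have h : ∀ᵐ x : ℝ ∂volume.restrict (Set.Ioc (-Real.pi) (-Real.pi + 2 * Real.pi)),
        G (x : AddCircle (2 * Real.pi)) = (f x : ℂ) :=
      (ae_restrict_iff' measurableSet_Ioc).2 (Filter.Eventually.of_forall fun x hx =>
        AddCircle.liftIoc_coe_apply hx)
    exact (congrArg ae hcirc).symm ▸ h
  have hGm : MemLp G p volume := hf.memLp_liftIoc
  rw [← SetLike.mem_coe, ← (Submodule.isClosed_topologicalClosure _).closure_eq,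
    EMetric.mem_closure_iff]
  intro ε hε
  obtain ⟨δ, hδ, hδε⟩ := exists_between hε
  obtain ⟨g, hg, hgm⟩ := hGm.exists_boundedContinuous_eLpNorm_sub_le hp hδ.ne'
  refine ⟨circleToLp p g.toContinuousMap, circleToLp_mem_closure p _, lt_of_le_of_lt ?_ hδε⟩
  rw [Lp.edist_def]
  refine le_trans ?_ hg
  rw [← eLpNorm_comp_measurePreserving (hGm.sub hgm).aestronglyMeasurable mp]
  refine eLpNorm_mono_ae ?_
  filter_upwards [hGf, coeFn_circleToLp p g.toContinuousMap] with x h1 h2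
  simp only [Pi.sub_apply, h2, Function.comp_apply, h1]
  have := Complex.abs_re_le_norm ((f x : ℂ) - g (x : AddCircle (2 * Real.pi)))
  simpa using this


/-! ### The Hausdorff–Young theorem by real interpolation. -/

theorem lintegral_Ioi_rpow_of_lt {a c : ℝ} (ha : a < -1) (hc : 0 < c) :
    ∫⁻ t in Set.Ioi c, ENNReal.ofReal (t ^ a) = ENNReal.ofReal (-c ^ (a + 1) / (a + 1)) := by
  rw [← integral_Ioi_rpow_of_lt ha hc,
    ofReal_integral_eq_lintegral_ofReal (integrableOn_Ioi_rpow_of_lt ha hc)]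
  refine (ae_restrict_iff' measurableSet_Ioi).2 (Filter.Eventually.of_forall fun t ht => ?_)
  exact Real.rpow_nonneg (hc.trans ht).le a

/-- If a Fourier coefficient is large compared to the `L^1` bound for the part of `f` above
height `t`, then it is controlled by the coefficient of the part of `f` below height `t`. -/
theorem sum_large_coeff_sq_le {f : ℝ → ℝ} (hf : Measurable f) {ρ A t : ℝ} (hρ : 1 < ρ)
    (hfi : Integrable f circMeasure) (hfρ : Integrable (fun x => |f x| ^ ρ) circMeasure)
    (hA : ∫ x, |f x| ^ ρ ∂circMeasure ≤ A) (ht : 0 < t) (s : Finset ℕ) :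
    ∑ n ∈ s, (if 2 * A * t ^ (1 - ρ) < |coeff f n| then coeff f n ^ 2 else 0) ≤
      4 * ∫ x, (if |f x| ≤ t then f x ^ 2 else 0) ∂circMeasure := by
  have hset : MeasurableSet {x | |f x| ≤ t} := measurableSet_le hf.abs measurable_const
  -- The low part `u` is bounded, so Bessel applies. The high part `v` satisfies `|v| ≤ t^(1-ρ)
  -- |f|^ρ`, so its coefficients are at most half of any coefficient counted on the left.
  set u : ℝ → ℝ := fun x => if |f x| ≤ t then f x else 0 with hu
  set v : ℝ → ℝ := fun x => if |f x| ≤ t then 0 else f x with hv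
  have hum : Measurable u := Measurable.ite hset hf measurable_const
  have hvm : Measurable v := Measurable.ite hset measurable_const hf
  have hub : ∀ x, ‖u x‖ ≤ t := by
    intro x
    simp only [hu]
    split_ifs with h
    · exact h
    · simpa using ht.le
  have hu2 : MemLp u 2 circMeasure :=
    MemLp.of_bound hum.aestronglyMeasurable t (Filter.Eventually.of_forall hub)
  have hui : Integrable u circMeasure := hu2.integrable (by norm_num)
  have hvi : Integrable v circMeasure := by
    refine hfi.mono hvm.aestronglyMeasurable (Filter.Eventually.of_forall fun x => ?_)
    simp only [hv]
    split_ifs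
    · simp
    · exact le_rfl
  have hsum : ∀ n, coeff f n = coeff u n + coeff v n := by
    intro n
    rw [← coeff_add hui hvi]
    congr 1
    ext x
    simp only [hu, hv]
    split_ifs <;> simp
  have hvle : ∀ n, |coeff v n| ≤ A * t ^ (1 - ρ) := by
    intro n
    refine (abs_coeff_le hvi n).trans ?_
    calc ∫ x, |v x| ∂circMeasure
        ≤ ∫ x, t ^ (1 - ρ) * |f x| ^ ρ ∂circMeasure := by
          refine integral_mono hvi.abs (hfρ.const_mul _) fun x => ?_
          simp only [hv]
          split_ifs with h
          · rw [abs_zero]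
            positivity
          · have hx : 0 < |f x| := ht.trans (not_le.1 h)
            calc |f x| = |f x| ^ (1 - ρ) * |f x| ^ ρ := by
                  rw [← Real.rpow_add hx]
                  simp
              _ ≤ t ^ (1 - ρ) * |f x| ^ ρ := by
                  refine mul_le_mul_of_nonneg_right ?_ (by positivity)
                  exact Real.rpow_le_rpow_of_nonpos ht (not_le.1 h).le (by linarith)
      _ = t ^ (1 - ρ) * ∫ x, |f x| ^ ρ ∂circMeasure := integral_const_mul _ _
      _ ≤ A * t ^ (1 - ρ) := by
          rw [mul_comm]
          gcongr
  have hterm : ∀ n, (if 2 * A * t ^ (1 - ρ) < |coeff f n| then coeff f n ^ 2 else 0) ≤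
      4 * coeff u n ^ 2 := by
    intro n
    split_ifs with h
    · have h1 := hvle n
      have h2 : |coeff f n| ≤ |coeff u n| + |coeff v n| := hsum n ▸ abs_add_le _ _
      have h3 : |coeff f n| ≤ 2 * |coeff u n| := by linarith
      have h4 := pow_le_pow_left₀ (abs_nonneg _) h3 2
      rw [mul_pow, sq_abs, sq_abs] at h4
      linarith
    · positivity
  calc _ ≤ ∑ n ∈ s, 4 * coeff u n ^ 2 := Finset.sum_le_sum fun n _ => hterm n
    _ = 4 * ∑ n ∈ s, coeff u n ^ 2 := by rw [Finset.mul_sum]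
    _ ≤ 4 * ∫ x, u x ^ 2 ∂circMeasure := by
        gcongr
        exact sum_coeff_sq_le hu2 s
    _ = _ := by
        congr 2
        ext x
        simp only [hu]
        split_ifs <;> simp

/-- The weight `t^(ρ-3)` is chosen so that integrating `y²` over heights `t ≥ |y|` returns a
multiple of `|y|^ρ`; convergence at infinity needs `ρ < 2`. -/
theorem lintegral_rpow_mul_sq_below {ρ : ℝ} (hρ : ρ < 2) (y : ℝ) :
    ∫⁻ t in Set.Ioi (0 : ℝ), ENNReal.ofReal (t ^ (ρ - 3)) *
      ENNReal.ofReal (if |y| ≤ t then y ^ 2 else 0) ≤ ENNReal.ofReal (|y| ^ ρ / (2 - ρ)) := by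
  rcases eq_or_ne y 0 with rfl | hy
  · simp
  have hy' : 0 < |y| := abs_pos.2 hy
  have h1 : ∀ t : ℝ, ENNReal.ofReal (t ^ (ρ - 3)) *
      ENNReal.ofReal (if |y| ≤ t then y ^ 2 else 0) =
      (Set.Ici |y|).indicator (fun t => ENNReal.ofReal (t ^ (ρ - 3)) * ENNReal.ofReal (y ^ 2)) t := by
    intro t
    by_cases h : |y| ≤ t <;> simp [h]
  simp_rw [h1]
  calc _ ≤ ∫⁻ t, (Set.Ici |y|).indicator
          (fun t => ENNReal.ofReal (t ^ (ρ - 3)) * ENNReal.ofReal (y ^ 2)) t :=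
        setLIntegral_le_lintegral _ _
    _ = ∫⁻ t in Set.Ioi |y|, ENNReal.ofReal (t ^ (ρ - 3)) * ENNReal.ofReal (y ^ 2) := by
        rw [lintegral_indicator measurableSet_Ici, restrict_Ioi_eq_restrict_Ici]
    _ = ENNReal.ofReal (-|y| ^ (ρ - 3 + 1) / (ρ - 3 + 1)) * ENNReal.ofReal (y ^ 2) := by
        rw [lintegral_mul_const' _ _ ENNReal.ofReal_ne_top,
          lintegral_Ioi_rpow_of_lt (by linarith) hy']
    _ ≤ _ := by
        rw [← ENNReal.ofReal_mul' (by positivity)]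
        refine ENNReal.ofReal_le_ofReal (le_of_eq ?_)
        have h2 : |y| ^ ρ = |y| ^ (ρ - 3 + 1) * y ^ 2 := by
          rw [← sq_abs, ← Real.rpow_natCast, ← Real.rpow_add hy']
          congr 1
          push_cast
          ring
        rw [h2, show ρ - 3 + 1 = -(2 - ρ) by ring, neg_div_neg_eq]
        ring

/-- The same weight on the coefficient side: the condition selects `t` beyond a power of `B / |c|`,
and `2 - (ρ-2)/(ρ-1) = ρ/(ρ-1)` is the conjugate exponent. -/
theorem le_lintegral_rpow_mul_sq_above {ρ B : ℝ} (hρ1 : 1 < ρ) (hρ : ρ < 2) (hB : 0 < B) (c : ℝ) :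
    ENNReal.ofReal (B ^ ((ρ - 2) / (ρ - 1)) / (2 - ρ) * |c| ^ (ρ / (ρ - 1))) ≤
    ∫⁻ t in Set.Ioi (0 : ℝ), ENNReal.ofReal (t ^ (ρ - 3)) *
      ENNReal.ofReal (if B * t ^ (1 - ρ) < |c| then c ^ 2 else 0) := by
  have hρ' : 0 < ρ - 1 := by linarith
  rcases eq_or_ne c 0 with rfl | hc
  · rw [abs_zero, Real.zero_rpow (by positivity)]
    simp
  have hc' : 0 < |c| := abs_pos.2 hc
  -- The height at which `B t^(1-ρ) = |c|`.
  set L := (B / |c|) ^ (1 / (ρ - 1)) with hL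
  have hL0 : 0 < L := by positivity
  have hmem : ∀ t ∈ Set.Ioi L, B * t ^ (1 - ρ) < |c| := by
    intro t ht
    have ht0 : 0 < t := hL0.trans ht
    have h1 : B / |c| < t ^ (ρ - 1) := by
      have := Real.rpow_lt_rpow hL0.le ht hρ'
      rwa [hL, ← Real.rpow_mul (by positivity), one_div_mul_cancel hρ'.ne', Real.rpow_one] at this
    rw [show 1 - ρ = -(ρ - 1) by ring, Real.rpow_neg ht0.le, ← div_eq_mul_inv,
      div_lt_iff₀ (by positivity)]
    rw [div_lt_iff₀ hc'] at h1
    linarith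
  calc _ = ENNReal.ofReal (-L ^ (ρ - 3 + 1) / (ρ - 3 + 1)) * ENNReal.ofReal (c ^ 2) := by
        rw [← ENNReal.ofReal_mul' (by positivity)]
        congr 1
        rw [show ρ - 3 + 1 = -(2 - ρ) by ring, neg_div_neg_eq, hL,
          ← Real.rpow_mul (by positivity), Real.div_rpow hB.le hc'.le, ← sq_abs c]
        have e1 : 1 / (ρ - 1) * -(2 - ρ) = (ρ - 2) / (ρ - 1) := by ring
        have e2 : |c| ^ (ρ / (ρ - 1)) = |c| ^ 2 / |c| ^ ((ρ - 2) / (ρ - 1)) := by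
          rw [← Real.rpow_natCast |c| 2, ← Real.rpow_sub hc']
          congr 1
          push_cast
          field_simp
          ring
        rw [e1, e2]
        field_simp
    _ = ∫⁻ t in Set.Ioi L, ENNReal.ofReal (t ^ (ρ - 3)) * ENNReal.ofReal (c ^ 2) := by
        rw [lintegral_mul_const' _ _ ENNReal.ofReal_ne_top,
          lintegral_Ioi_rpow_of_lt (by linarith) hL0]
    _ = ∫⁻ t in Set.Ioi L, ENNReal.ofReal (t ^ (ρ - 3)) *
          ENNReal.ofReal (if B * t ^ (1 - ρ) < |c| then c ^ 2 else 0) := by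
        refine setLIntegral_congr_fun measurableSet_Ioi fun t ht => ?_
        simp only [if_pos (hmem t ht)]
    _ ≤ _ := lintegral_mono_set (Set.Ioi_subset_Ioi hL0.le)

/-- Multiply `sum_large_coeff_sq_le` by `t^(ρ-3)`, integrate over `t > 0` and swap the integrals by
Tonelli. The bound `D` may depend on `f` in any way; only finiteness matters. -/
theorem sum_coeff_rpow_le {f : ℝ → ℝ} (hf : Measurable f) {ρ : ℝ} (hρ1 : 1 < ρ) (hρ : ρ < 2)
    (hfi : Integrable f circMeasure) (hfρ : Integrable (fun x => |f x| ^ ρ) circMeasure) :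
    ∃ D : ℝ, ∀ s : Finset ℕ, ∑ n ∈ s, |coeff f n| ^ (ρ / (ρ - 1)) ≤ D := by
  -- The added `1` keeps the threshold positive when `f` vanishes almost everywhere.
  set A := ∫ x, |f x| ^ ρ ∂circMeasure + 1 with hA
  have hI : 0 ≤ ∫ x, |f x| ^ ρ ∂circMeasure := integral_nonneg fun x => by positivity
  have hB : 0 < 2 * A := by positivity
  set K := (2 * A) ^ ((ρ - 2) / (ρ - 1)) / (2 - ρ) with hK
  have hK0 : 0 < K := div_pos (by positivity) (by linarith)
  set J := ∫ x, |f x| ^ ρ / (2 - ρ) ∂circMeasure with hJ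
  have hJ0 : 0 ≤ J := integral_nonneg fun x => div_nonneg (by positivity) (by linarith)
  refine ⟨4 * J / K, fun s => ?_⟩
  rw [le_div_iff₀ hK0, ← ENNReal.ofReal_le_ofReal_iff (by positivity), mul_comm, Finset.mul_sum,
    ENNReal.ofReal_sum_of_nonneg fun n _ => by positivity]
  have hmeas : Measurable (Function.uncurry fun (t x : ℝ) => ENNReal.ofReal (t ^ (ρ - 3)) *
      ENNReal.ofReal (if |f x| ≤ t then f x ^ 2 else 0)) := by
    refine Measurable.mul (by fun_prop) (Measurable.ennreal_ofReal ?_)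
    refine Measurable.ite (measurableSet_le ?_ measurable_fst) ?_ measurable_const
    · exact (hf.comp measurable_snd).abs
    · exact (hf.comp measurable_snd).pow_const 2
  have hmeas2 : ∀ n, Measurable fun t : ℝ => ENNReal.ofReal (t ^ (ρ - 3)) *
      ENNReal.ofReal (if 2 * A * t ^ (1 - ρ) < |coeff f n| then coeff f n ^ 2 else 0) := by
    intro n
    refine Measurable.mul (by fun_prop) (Measurable.ennreal_ofReal ?_)
    exact Measurable.ite (measurableSet_lt (by fun_prop) measurable_const) measurable_const
      measurable_const
  calc _ ≤ ∑ n ∈ s, ∫⁻ t in Set.Ioi (0 : ℝ), ENNReal.ofReal (t ^ (ρ - 3)) *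
        ENNReal.ofReal (if 2 * A * t ^ (1 - ρ) < |coeff f n| then coeff f n ^ 2 else 0) :=
        Finset.sum_le_sum fun n _ => le_lintegral_rpow_mul_sq_above hρ1 hρ hB (coeff f n)
    _ = ∫⁻ t in Set.Ioi (0 : ℝ), ∑ n ∈ s, ENNReal.ofReal (t ^ (ρ - 3)) *
        ENNReal.ofReal (if 2 * A * t ^ (1 - ρ) < |coeff f n| then coeff f n ^ 2 else 0) :=
        (lintegral_finsetSum _ fun n _ => hmeas2 n).symm
    _ ≤ ∫⁻ t in Set.Ioi (0 : ℝ), 4 * ∫⁻ x, ENNReal.ofReal (t ^ (ρ - 3)) *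
        ENNReal.ofReal (if |f x| ≤ t then f x ^ 2 else 0) ∂circMeasure := by
        refine setLIntegral_mono' measurableSet_Ioi fun t ht => ?_
        have hi : Integrable (fun x => if |f x| ≤ t then f x ^ 2 else 0) circMeasure := by
          refine Integrable.of_bound (C := t ^ 2) ?_ (Filter.Eventually.of_forall fun x => ?_)
          · exact (Measurable.ite (measurableSet_le hf.abs measurable_const) (hf.pow_const 2)
              measurable_const).aestronglyMeasurable
          · split_ifs with h
            · rw [Real.norm_eq_abs, abs_of_nonneg (sq_nonneg _), ← sq_abs]
              exact pow_le_pow_left₀ (abs_nonneg _) h 2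
            · simpa using sq_nonneg t
        rw [← Finset.mul_sum, lintegral_const_mul' _ _ ENNReal.ofReal_ne_top, mul_left_comm]
        gcongr
        rw [← ENNReal.ofReal_sum_of_nonneg fun n _ => by split_ifs <;> positivity,
          ← ofReal_integral_eq_lintegral_ofReal hi
            (Filter.Eventually.of_forall fun x => by dsimp only; split_ifs <;> positivity),
          show (4 : ℝ≥0∞) = ENNReal.ofReal 4 by simp, ← ENNReal.ofReal_mul (by norm_num)]
        exact ENNReal.ofReal_le_ofReal
          (sum_large_coeff_sq_le hf hρ1 hfi hfρ (by linarith) ht s)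
    _ = 4 * ∫⁻ x, (∫⁻ t in Set.Ioi (0 : ℝ), ENNReal.ofReal (t ^ (ρ - 3)) *
        ENNReal.ofReal (if |f x| ≤ t then f x ^ 2 else 0)) ∂circMeasure := by
        rw [lintegral_const_mul' _ _ (by norm_num), lintegral_lintegral_swap hmeas.aemeasurable]
    _ ≤ 4 * ∫⁻ x, ENNReal.ofReal (|f x| ^ ρ / (2 - ρ)) ∂circMeasure := by
        gcongr with x
        exact lintegral_rpow_mul_sq_below hρ (f x)
    _ = ENNReal.ofReal (4 * J) := by
        rw [← ofReal_integral_eq_lintegral_ofReal (hfρ.div_const _)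
            (Filter.Eventually.of_forall fun x => div_nonneg (by positivity) (by linarith)),
          ENNReal.ofReal_mul (by norm_num)]
        simp [hJ]

theorem toReal_conjExponent {s : ℝ≥0∞} (hs : 1 < s) (hst : s ≠ ∞) :
    (ENNReal.conjExponent s).toReal = s.toReal / (s.toReal - 1) := by
  have h1 : 1 < s.toReal := by
    rw [← ENNReal.toReal_one]
    exact (ENNReal.toReal_lt_toReal (by norm_num) hst).2 hs
  rw [ENNReal.conjExponent, ENNReal.toReal_add (by norm_num)
    (ENNReal.inv_ne_top.2 (tsub_pos_of_lt hs).ne'), ENNReal.toReal_inv,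
    ENNReal.toReal_sub_of_le hs.le hst, ENNReal.toReal_one]
  have : s.toReal - 1 ≠ 0 := by linarith
  field_simp
  ring

/-- The Fourier coefficients of a function in `L^r`, `1 < r ≤ 2`, form a sequence
in `ℓ^{r'}`. -/
theorem memℓp_coeff {r : ℝ≥0∞} (hr1 : 1 < r) (hr2 : r ≤ 2) {f : ℝ → ℝ}
    (hf : MemLp f r circMeasure) : Memℓp (coeff f) (ENNReal.conjExponent r) := by
  have hrt : r ≠ ∞ := (hr2.trans_lt (by norm_num)).ne
  have hr0 : r ≠ 0 := (zero_lt_one.trans hr1).ne'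
  have hρ1 : 1 < r.toReal := by
    rw [← ENNReal.toReal_one]
    exact (ENNReal.toReal_lt_toReal (by norm_num) hrt).2 hr1
  have hconj := toReal_conjExponent hr1 hrt
  -- The interpolation argument has the factor `1/(2-ρ)`, so the endpoint is taken directly from
  -- Bessel.
  rcases eq_or_ne r 2 with rfl | hne
  · refine memℓp_gen' (C := ∫ x, f x ^ 2 ∂circMeasure) fun s => ?_
    rw [hconj]
    have h2 : (2 : ℝ≥0∞).toReal / ((2 : ℝ≥0∞).toReal - 1) = (2 : ℕ) := by norm_num
    simp only [h2, Real.rpow_natCast, Real.norm_eq_abs, sq_abs]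
    exact sum_coeff_sq_le hf s
  · have hρ2 : r.toReal < 2 := by
      have := (ENNReal.toReal_lt_toReal hrt (by norm_num)).2 (lt_of_le_of_ne hr2 hne)
      simpa using this
    set g := hf.1.mk f
    have hfg : f =ᵐ[circMeasure] g := hf.1.ae_eq_mk
    have hgL : MemLp g r circMeasure := (memLp_congr_ae hfg).1 hf
    have hgρ : Integrable (fun x => |g x| ^ r.toReal) circMeasure :=
      hgL.integrable_norm_rpow hr0 hrt
    obtain ⟨D, hD⟩ := sum_coeff_rpow_le hf.1.stronglyMeasurable_mk.measurable hρ1 hρ2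
      (hgL.integrable hr1.le) hgρ
    refine memℓp_gen' (C := D) fun s => ?_
    rw [hconj]
    simp only [Real.norm_eq_abs, coeff_congr_ae hfg]
    exact hD s

/-! ### Continuity of the coefficients and of the Fourier operator. -/

theorem exists_abs_coeff_le (p : ℝ≥0∞) [hp : Fact (1 ≤ p)] :
    ∃ K : ℝ, ∀ (f : LpT p) n, |coeff f n| ≤ K * ‖f‖ := by
  -- The Hölder constant `(2π)^(1 - 1/p)` of the inclusion `L^p → L^1`.
  refine ⟨(circMeasure Set.univ ^ (1 / (1 : ℝ≥0∞).toReal - 1 / p.toReal)).toReal, fun f n => ?_⟩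
  have hf := Lp.memLp f
  refine (abs_coeff_le (hf.integrable hp.out) n).trans ?_
  have h1 := eLpNorm_le_eLpNorm_mul_rpow_measure_univ hp.out hf.1
  have h2 : ∫ x, |f x| ∂circMeasure = (eLpNorm f 1 circMeasure).toReal := by
    rw [eLpNorm_one_eq_lintegral_enorm]
    exact integral_norm_eq_lintegral_enorm hf.1
  rw [h2, Lp.norm_def, mul_comm, ← ENNReal.toReal_mul]
  refine ENNReal.toReal_mono (ENNReal.mul_ne_top hf.2.ne ?_) h1
  refine ENNReal.rpow_ne_top_of_nonneg ?_ (measure_ne_top _ _)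
  rw [ENNReal.toReal_one, div_one, sub_nonneg]
  rcases eq_or_ne p ∞ with rfl | hpt
  · simp
  · have : 1 ≤ p.toReal := by
      rw [← ENNReal.toReal_one]
      exact (ENNReal.toReal_le_toReal (by norm_num) hpt).2 hp.out
    exact (div_le_one (by linarith)).2 this

/-- The `n`-th Fourier coefficient as a continuous linear functional on `L^p[-π, π]`. -/
noncomputable def coeffL (p : ℝ≥0∞) [hp : Fact (1 ≤ p)] (n : ℕ) : LpT p →L[ℝ] ℝ :=
  LinearMap.mkContinuousOfExistsBound
    { toFun := fun f => coeff f n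
      map_add' := fun f g => by
        rw [coeff_congr_ae (Lp.coeFn_add f g)]
        exact coeff_add ((Lp.memLp f).integrable hp.out) ((Lp.memLp g).integrable hp.out) n
      map_smul' := fun c f => by
        rw [coeff_congr_ae (Lp.coeFn_smul c f)]
        exact coeff_const_mul c f n }
    ((exists_abs_coeff_le p).imp fun K hK f => hK f n)

/-- The Fourier operator `L^r → ℓ^{r'}` for `1 < r ≤ 2`. -/
noncomputable def fourierOp {r : ℝ≥0∞} [Fact (1 ≤ r)] (hr1 : 1 < r) (hr2 : r ≤ 2) :
    LpT r →L[ℝ] ellp (ENNReal.conjExponent r) :=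
  ContinuousLinearMap.ofSeqClosedGraph
    (g :=
      { toFun := fun f => ⟨coeff f, memℓp_coeff hr1 hr2 (Lp.memLp f)⟩
        map_add' := fun f g => by
          ext n
          exact (coeffL r n).map_add f g
        map_smul' := fun c f => by
          ext n
          exact (coeffL r n).map_smul c f }) <| by
    intro u x y hu hy
    ext n
    -- Closed graph: convergence in `L^r` and in `ℓ^{r'}` each forces convergence of the `n`-th
    -- coefficient, so the two limits agree.
    refine tendsto_nhds_unique (f := fun k => coeffL r n (u k)) (l := Filter.atTop) ?_
      (((coeffL r n).continuous.tendsto x).comp hu)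
    have h : LipschitzWith 1 fun z : ellp (ENNReal.conjExponent r) => z n := by
      refine LipschitzWith.of_dist_le_mul fun z w => ?_
      rw [NNReal.coe_one, one_mul, dist_eq_norm, dist_eq_norm]
      exact lp.norm_apply_le_norm (by simp [ENNReal.conjExponent]) (z - w) n
    exact (h.continuous.tendsto y).comp hy


/-! ### Exponents and the duality between `ℓ^s` and `ℓ^{s'}`. -/

theorem one_lt_sExp {p q : ℝ≥0∞} (hp : 1 ≤ p) (hq : 1 < q) : 1 < sExp p q := by
  unfold sExp
  split_ifs with h1 h2
  · exact ENNReal.one_lt_top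
  · exact hq
  · have hqp : q < p := not_le.1 h1
    have hp0 : p ≠ 0 := (zero_lt_one.trans_le hp).ne'
    rw [ENNReal.lt_div_iff_mul_lt (Or.inl (tsub_pos_of_lt hqp).ne')
      (Or.inl (ENNReal.sub_ne_top h2)), one_mul]
    calc p - q ≤ p := tsub_le_self
      _ = p * 1 := (mul_one p).symm
      _ < p * q := ENNReal.mul_lt_mul_right hp0 h2 hq

theorem holderConjugate_toReal {s : ℝ≥0∞} (hs : 1 < s) (hst : s ≠ ∞) :
    s.toReal.HolderConjugate (ENNReal.conjExponent s).toReal := by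
  rw [toReal_conjExponent hs hst]
  refine Real.HolderConjugate.conjExponent ?_
  rw [← ENNReal.toReal_one]
  exact (ENNReal.toReal_lt_toReal (by norm_num) hst).2 hs

/-- For `s > 1` the conjugate exponent is finite, so `toReal` does not fall to its default `0` and
the powers `|b|^{s'}` have their usual meaning. -/
theorem toReal_conjExponent_pos {s : ℝ≥0∞} (hs : 1 < s) :
    0 < (ENNReal.conjExponent s).toReal := by
  rcases eq_or_ne s ∞ with rfl | hst
  · simp [ENNReal.conjExponent]
  · exact (holderConjugate_toReal hs hst).symm.pos

/-- Boundedness of the functionals `b ↦ ∑ b_k d_k` by the `ℓ^{s'}`-norm characterizes `d ∈ ℓ^s`. -/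
theorem exists_sum_mul_le_iff_memℓp {s : ℝ≥0∞} (hs : 1 < s) (d : ℕ → ℝ) :
    (∃ C : ℝ, 0 < C ∧ ∀ (n : ℕ) (b : ℕ → ℝ), ∑ k ∈ Finset.range n, b k * d k ≤
      C * (∑ k ∈ Finset.range n, |b k| ^ (ENNReal.conjExponent s).toReal) ^
        (1 / (ENNReal.conjExponent s).toReal)) ↔ Memℓp d s := by
  rcases eq_or_ne s ∞ with rfl | hst
  · have h1 : (ENNReal.conjExponent ∞).toReal = 1 := by simp [ENNReal.conjExponent]
    simp only [h1, Real.rpow_one, div_one]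
    constructor
    · rintro ⟨C, -, h⟩
      refine memℓp_infty ⟨C, ?_⟩
      rintro _ ⟨k, rfl⟩
      have h2 := fun c => h (k + 1) (Pi.single k c)
      have h3 : ∀ c : ℝ, ∑ i ∈ Finset.range (k + 1), (Pi.single k c : ℕ → ℝ) i * d i = c * d k := by
        intro c
        rw [Finset.sum_eq_single k] <;> simp +contextual
      have h4 : ∀ c : ℝ, ∑ i ∈ Finset.range (k + 1), |(Pi.single k c : ℕ → ℝ) i| = |c| := by
        intro c
        rw [Finset.sum_eq_single k] <;> simp +contextual
      simp only [h3, h4] at h2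
      have h5 := h2 1
      have h6 := h2 (-1)
      simp only [abs_neg, abs_one, mul_one, one_mul, neg_mul] at h5 h6
      exact abs_le.2 ⟨by linarith, h5⟩
    · intro h
      obtain ⟨C, hC⟩ := memℓp_infty_iff.1 h
      have hC' : ∀ k, |d k| ≤ C := fun k => hC ⟨k, rfl⟩
      refine ⟨|C| + 1, by positivity, fun n b => ?_⟩
      rw [Finset.mul_sum]
      refine Finset.sum_le_sum fun k _ => (le_abs_self _).trans ?_
      rw [abs_mul, mul_comm]
      refine mul_le_mul_of_nonneg_right ?_ (abs_nonneg _)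
      linarith [hC' k, le_abs_self C]
  · have hc := holderConjugate_toReal hs hst
    set σ := s.toReal
    set τ := (ENNReal.conjExponent s).toReal
    have hσ := hc.pos
    have hτ := hc.symm.pos
    constructor
    · rintro ⟨C, hC, h⟩
      refine memℓp_gen' (C := C ^ σ) fun S => ?_
      obtain ⟨n, hn⟩ : ∃ n, S ⊆ Finset.range n := by
        obtain ⟨n, hn⟩ := S.bddAbove
        exact ⟨n + 1, fun k hk => Finset.mem_range.2 (Nat.lt_succ_of_le (hn hk))⟩
      refine (Finset.sum_le_sum_of_subset_of_nonneg hn fun k _ _ => by positivity).trans ?_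
      simp only [Real.norm_eq_abs]
      -- The extremal sequence in Hölder's inequality: with `R = ∑ |d k|^σ` the hypothesis becomes
      -- `R ≤ C R^(1/τ)`, hence `R^(1/σ) ≤ C` unless `R = 0`.
      have h1 := h n fun k => SignType.sign (d k) * |d k| ^ (σ - 1)
      have h2 : ∀ k, (SignType.sign (d k) : ℝ) * |d k| ^ (σ - 1) * d k = |d k| ^ σ := by
        intro k
        rcases eq_or_ne (d k) 0 with h0 | h0
        · simp [h0, Real.zero_rpow hσ.ne']
        · rw [mul_right_comm, sign_mul_self, mul_comm, ← Real.rpow_add_one (abs_ne_zero.2 h0)]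
          simp
      have h3 : ∀ k, |(SignType.sign (d k) : ℝ) * |d k| ^ (σ - 1)| ^ τ = |d k| ^ σ := by
        intro k
        rcases eq_or_ne (d k) 0 with h0 | h0
        · simp [h0, Real.zero_rpow hσ.ne', Real.zero_rpow hτ.ne']
        · have h4 : |(SignType.sign (d k) : ℝ)| = 1 := by
            rcases lt_or_gt_of_ne h0 with h5 | h5
            · simp [sign_neg h5]
            · simp [sign_pos h5]
          rw [abs_mul, h4, one_mul, abs_of_nonneg (by positivity), ← Real.rpow_mul (abs_nonneg _),
            hc.sub_one_mul_conj]
      simp only [h2, h3] at h1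
      set R := ∑ k ∈ Finset.range n, |d k| ^ σ with hR
      have hR0 : 0 ≤ R := Finset.sum_nonneg fun k _ => by positivity
      rcases hR0.eq_or_lt with h0 | h0
      · rw [← h0]
        positivity
      · have h5 : 1 / τ = 1 - 1 / σ := by
          have := hc.one_div_add_one_div
          linarith
        rw [h5, Real.rpow_sub h0, Real.rpow_one, ← mul_div_assoc,
          le_div_iff₀ (by positivity), mul_comm, mul_le_mul_iff_left₀ h0] at h1
        calc R = (R ^ (1 / σ)) ^ σ := by
              rw [← Real.rpow_mul hR0, one_div_mul_cancel hσ.ne', Real.rpow_one]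
          _ ≤ C ^ σ := Real.rpow_le_rpow (by positivity) h1 hσ.le
    · intro h
      have hsum : Summable fun k => |d k| ^ σ := by
        simpa using h.summable hσ
      -- The `ℓ^s`-norm of `d`, plus `1` for strict positivity when `d = 0`.
      refine ⟨(∑' k, |d k| ^ σ) ^ (1 / σ) + 1, ?_, fun n b => ?_⟩
      · have : 0 ≤ ∑' k, |d k| ^ σ := tsum_nonneg fun k => by positivity
        positivity
      · refine (Real.inner_le_Lp_mul_Lq _ _ _ hc.symm).trans ?_
        rw [mul_comm]
        refine mul_le_mul_of_nonneg_right ?_ (by positivity)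
        have : (∑ k ∈ Finset.range n, |d k| ^ σ) ^ (1 / σ) ≤ (∑' k, |d k| ^ σ) ^ (1 / σ) := by
          gcongr
          exact hsum.sum_le_tsum _ fun k _ => by positivity
        linarith

/-- In the estimate by the `ℓ^{s'}`-norm it suffices to consider sequences bounded by `1`. -/
theorem sum_mul_le_of_abs_le_one {τ : ℝ} (hτ : 0 < τ) {C : ℝ} {d : ℕ → ℝ} {n : ℕ}
    (h : ∀ b : ℕ → ℝ, (∀ k, |b k| ≤ 1) → ∑ k ∈ Finset.range n, b k * d k ≤
      C * (∑ k ∈ Finset.range n, |b k| ^ τ) ^ (1 / τ)) (b : ℕ → ℝ) :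
    ∑ k ∈ Finset.range n, b k * d k ≤ C * (∑ k ∈ Finset.range n, |b k| ^ τ) ^ (1 / τ) := by
  -- Both sides are homogeneous of degree one in `b`, so dividing by any positive bound for the
  -- first `n` terms is enough. The later terms are cut off, since `h` asks for a bound at every
  -- index.
  set M := 1 + ∑ k ∈ Finset.range n, |b k| with hM
  have hM0 : 0 < M := by positivity
  have hb : ∀ k ∈ Finset.range n, |b k| ≤ M := fun k hk => by
    have := Finset.single_le_sum (f := fun k => |b k|) (fun i _ => abs_nonneg _) hk
    linarith
  have h1 := h (fun k => if k ∈ Finset.range n then b k / M else 0) fun k => by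
    split_ifs with hk
    · rw [abs_div, abs_of_pos hM0]
      exact (div_le_one hM0).2 (hb k hk)
    · simp
  have h2 : ∑ k ∈ Finset.range n, (if k ∈ Finset.range n then b k / M else 0) * d k =
      (∑ k ∈ Finset.range n, b k * d k) / M := by
    rw [Finset.sum_div]
    refine Finset.sum_congr rfl fun k hk => ?_
    rw [if_pos hk]
    ring
  have h3 : ∑ k ∈ Finset.range n, |if k ∈ Finset.range n then b k / M else 0| ^ τ =
      (∑ k ∈ Finset.range n, |b k| ^ τ) / M ^ τ := by
    rw [Finset.sum_div]
    refine Finset.sum_congr rfl fun k hk => ?_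
    rw [if_pos hk, abs_div, abs_of_pos hM0, Real.div_rpow (abs_nonneg _) hM0.le]
  rw [h2, h3, Real.div_rpow (by positivity) (by positivity), ← Real.rpow_mul hM0.le,
    mul_one_div_cancel hτ.ne', Real.rpow_one, ← mul_div_assoc] at h1
  exact (div_le_div_iff_of_pos_right hM0).1 h1

/-! ### Domination conditions for infinite matrices. -/

theorem sum_sum_eq_sum_diag {t a : ℕ → ℕ → ℝ} (n m : ℕ)
    (h : ∀ i j, i ≠ j → a i j * t i j = 0) :
    ∑ i ∈ Finset.range n, ∑ j ∈ Finset.range m, a i j * t i j =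
      ∑ i ∈ Finset.range (min n m), a i i * t i i := by
  have h1 : ∀ i, ∑ j ∈ Finset.range m, a i j * t i j = if i < m then a i i * t i i else 0 := by
    intro i
    split_ifs with hi
    · exact Finset.sum_eq_single i (fun j _ hj => h i j hj.symm)
        fun hi' => absurd (Finset.mem_range.2 hi) hi'
    · refine Finset.sum_eq_zero fun j hj => h i j fun hij => hi ?_
      exact hij ▸ Finset.mem_range.1 hj
  simp only [h1]
  rw [← Finset.sum_filter]
  congr 1
  ext i
  simp

/-- The matrix form of the domination condition characterizes diagonal matrices with diagonal
in `ℓ^s`. -/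
theorem matrix_domination_iff {s : ℝ≥0∞} (hs : 1 < s) (t : ℕ → ℕ → ℝ) :
    (∃ C : ℝ, 0 < C ∧ ∀ (n m : ℕ) (a : ℕ → ℕ → ℝ), (∀ i j, |a i j| ≤ 1) →
      ∑ i ∈ Finset.range n, ∑ j ∈ Finset.range m, a i j * t i j ≤
        C * (∑ i ∈ Finset.range (min n m), |a i i| ^ (ENNReal.conjExponent s).toReal) ^
          (1 / (ENNReal.conjExponent s).toReal)) ↔
    (∀ n i, i ≠ n → t i n = 0) ∧ Memℓp (fun i => t i i) s := by
  have hτ := toReal_conjExponent_pos hs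
  rw [← exists_sum_mul_le_iff_memℓp hs]
  constructor
  · rintro ⟨C, hC, h⟩
    refine ⟨fun n i hin => ?_, C, hC, fun n b => ?_⟩
    · have h1 : ∀ c : ℝ, |c| ≤ 1 → c * t i n ≤ 0 := by
        intro c hc
        -- A single off-diagonal entry `c`: the right side is zero, and `c = ±1` forces `t i n = 0`.
        have h2 := h (i + 1) (n + 1) (Pi.single i (Pi.single n c)) fun k l => by
          rcases eq_or_ne k i with rfl | hk
          · rcases eq_or_ne l n with rfl | hl
            · simpa using hc
            · simp [hl]
          · simp [hk]
        have h3 : ∀ k, (Pi.single i (Pi.single n c) : ℕ → ℕ → ℝ) k k = 0 := by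
          intro k
          rcases eq_or_ne k i with rfl | hk
          · simp [hin]
          · simp [hk]
        have h4 : ∑ k ∈ Finset.range (i + 1), ∑ l ∈ Finset.range (n + 1),
            (Pi.single i (Pi.single n c) : ℕ → ℕ → ℝ) k l * t k l = c * t i n := by
          rw [Finset.sum_eq_single i, Finset.sum_eq_single n] <;>
            simp +contextual [Pi.single_apply]
        rw [h4] at h2
        simpa only [h3, abs_zero, Real.zero_rpow hτ.ne', Finset.sum_const_zero,
          Real.zero_rpow (one_div_pos.2 hτ).ne', mul_zero] using h2
      have h5 := h1 1 (by simp)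
      have h6 := h1 (-1) (by simp)
      linarith
    · refine sum_mul_le_of_abs_le_one hτ (fun b hb => ?_) b
      have h1 := h n n (fun i j => if i = j then b i else 0) fun i j => by
        split_ifs
        · exact hb i
        · simp
      rw [sum_sum_eq_sum_diag n n fun i j hij => by simp [hij]] at h1
      simpa using h1
  · rintro ⟨h0, C, hC, h⟩
    refine ⟨C, hC, fun n m a _ => ?_⟩
    rw [sum_sum_eq_sum_diag n m fun i j hij => by rw [h0 j i hij, mul_zero]]
    exact h (min n m) fun i => a i i

/-- The row form of the domination condition characterizes diagonal matrices with bounded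
diagonal. -/
theorem row_domination_iff (t : ℕ → ℕ → ℝ) :
    (∃ C : ℝ, 0 < C ∧ ∀ (n m : ℕ) (a : ℕ → ℝ), (∀ j, |a j| ≤ 1) →
      ∑ j ∈ Finset.range m, a j * t n j ≤ C * (if n < m then |a n| else 0)) ↔
    (∀ n i, i ≠ n → t i n = 0) ∧ Memℓp (fun i => t i i) ∞ := by
  constructor
  · rintro ⟨C, hC, h⟩
    have h1 : ∀ (i n : ℕ) (c : ℝ), |c| ≤ 1 → c * t i n ≤ C * if i = n then |c| else 0 := by
      intro i n c hc
      -- A row with one entry `c` in column `n`. The right side survives only for `i = n`, so the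
      -- same test gives the zeros off the diagonal and the bound on it.
      have h2 := h i (n + 1) (Pi.single n c) fun l => by
        rcases eq_or_ne l n with rfl | hl
        · simpa using hc
        · simp [hl]
      rw [Finset.sum_eq_single n (by simp +contextual) (by simp)] at h2
      rcases eq_or_ne i n with rfl | hi
      · simpa using h2
      · simpa [hi] using h2
    refine ⟨fun n i hin => ?_, memℓp_infty ⟨C, ?_⟩⟩
    · have h5 := h1 i n 1 (by simp)
      have h6 := h1 i n (-1) (by simp)
      simp only [hin, if_false] at h5 h6
      linarith
    · rintro _ ⟨k, rfl⟩
      have h5 := h1 k k 1 (by simp)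
      have h6 := h1 k k (-1) (by simp)
      simp only [if_true, abs_neg, abs_one, mul_one, one_mul, neg_mul] at h5 h6
      exact abs_le.2 ⟨by linarith, h5⟩
  · rintro ⟨h0, h⟩
    obtain ⟨C, hC⟩ := memℓp_infty_iff.1 h
    have hC' : ∀ k, |t k k| ≤ C := fun k => hC ⟨k, rfl⟩
    refine ⟨|C| + 1, by positivity, fun n m a _ => ?_⟩
    have h1 : ∑ j ∈ Finset.range m, a j * t n j = if n < m then a n * t n n else 0 := by
      split_ifs with hn
      · exact Finset.sum_eq_single n (fun j _ hj => by rw [h0 j n hj.symm, mul_zero])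
          fun hn' => absurd (Finset.mem_range.2 hn) hn'
      · refine Finset.sum_eq_zero fun j hj => ?_
        rw [h0 j n fun hnj => hn (hnj ▸ Finset.mem_range.1 hj), mul_zero]
    rw [h1]
    split_ifs
    · refine (le_abs_self _).trans ?_
      rw [abs_mul, mul_comm]
      refine mul_le_mul_of_nonneg_right ?_ (abs_nonneg _)
      linarith [hC' n, le_abs_self C]
    · simp

/-! ### Factorization through the Fourier operator and the main theorem. -/

theorem coeff_trigLp (p : ℝ≥0∞) (n m : ℕ) : coeff (trigLp p n) m = if n = m then 1 else 0 := by
  rw [trigLp, coeff_congr_ae (memLp_trig p n).coeFn_toLp, coeff_trig]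

/-- An operator `L^p → ℓ^q` factors through the Fourier operator and a multiplication operator if
and only if its matrix in the trigonometric basis is diagonal with diagonal in `ℓ^{s_{r'q}}`. -/
theorem exists_factorization_iff {r p q : ℝ≥0∞} [Fact (1 ≤ r)] [Fact (1 ≤ p)] [Fact (1 ≤ q)]
    (hr1 : 1 < r) (hr2 : r ≤ 2) (hrp : r ≤ p) (hp : p ≠ ∞) (T : LpT p →L[ℝ] ellp q) :
    (∃ g : ellp (sExp (ENNReal.conjExponent r) q),
      ∀ f, T f = mulOp g (fourierOp hr1 hr2 (incl hrp f))) ↔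
    (∀ n i, i ≠ n → T (trigLp p n) i = 0) ∧
      Memℓp (fun i => T (trigLp p i) i) (sExp (ENNReal.conjExponent r) q) := by
  have happ : ∀ (g : ellp (sExp (ENNReal.conjExponent r) q)) (f : LpT p) (i : ℕ),
      mulOp g (fourierOp hr1 hr2 (incl hrp f)) i = g i * coeff f i := by
    intro g f i
    change g i * coeff (incl hrp f) i = _
    rw [coeff_congr_ae (f := incl hrp f) (g := f)]
    exact MemLp.coeFn_toLp ((Lp.memLp f).mono_exponent hrp)
  constructor
  · rintro ⟨g, hg⟩
    have h : ∀ n i, T (trigLp p n) i = g i * if n = i then 1 else 0 := by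
      intro n i
      rw [hg, happ, coeff_trigLp]
    refine ⟨fun n i hin => ?_, ?_⟩
    · simp [h, hin.symm]
    · simpa [h] using lp.memℓp g
  · rintro ⟨h0, hd⟩
    -- The multiplier is the diagonal itself, `g_i = T(φ_i)_i`.
    refine ⟨⟨_, hd⟩, fun f => ?_⟩
    ext i
    rw [happ]
    change T f i = T (trigLp p i) i * coeffL p i f
    have hcont : Continuous fun f => T f i := by
      have h : LipschitzWith 1 fun z : ellp q => z i := by
        refine LipschitzWith.of_dist_le_mul fun z w => ?_
        rw [NNReal.coe_one, one_mul, dist_eq_norm, dist_eq_norm]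
        exact lp.norm_apply_le_norm (zero_lt_one.trans_le (Fact.out : 1 ≤ q)).ne' (z - w) i
      exact h.continuous.comp T.continuous
    let Φ : LpT p →L[ℝ] ℝ :=
      { toFun := fun f => T f i
        map_add' := fun f g => by simp
        map_smul' := fun c f => by simp
        cont := hcont }
    suffices H : Φ = T (trigLp p i) i • coeffL p i from DFunLike.congr_fun H f
    refine ContinuousLinearMap.ext_on
      (Submodule.dense_iff_topologicalClosure_eq_top.2 (span_trigLp_closure_eq_top p hp)) ?_
    rintro _ ⟨n, rfl⟩
    change T (trigLp p n) i = T (trigLp p i) i * coeff (trigLp p n) i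
    rw [coeff_trigLp]
    rcases eq_or_ne n i with rfl | hni
    · simp
    · simp [h0 n i hni.symm, hni]

end FourierFactor

theorem proposition5p1 (r p q : ℝ≥0∞) [Fact (1 ≤ r)] [Fact (1 ≤ p)] [Fact (1 ≤ q)]
    (hr1 : 1 < r) (hr2 : r ≤ 2) (hrp : r ≤ p) (hp : p < ∞) (hq : 1 < q)
    (T : FourierFactor.LpT p →L[ℝ] FourierFactor.ellp q) :
    -- the Fourier operator from `L^r` to `ℓ^{r'}` is well defined and continuous, and
    ∃ F : FourierFactor.LpT r →L[ℝ] FourierFactor.ellp (ENNReal.conjExponent r),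
      (∀ f n, F f n = FourierFactor.coeff f n) ∧
      List.TFAE [
        ∃ g : FourierFactor.ellp (FourierFactor.sExp (ENNReal.conjExponent r) q),
          ∀ f, T f = FourierFactor.mulOp g (F (FourierFactor.incl hrp f)),
        (∀ n i, i ≠ n → T (FourierFactor.trigLp p n) i = 0) ∧
          Memℓp (fun i => T (FourierFactor.trigLp p i) i)
            (FourierFactor.sExp (ENNReal.conjExponent r) q),
        ∃ C : ℝ, 0 < C ∧ ∀ (n m : ℕ) (a : ℕ → ℕ → ℝ), (∀ i j, |a i j| ≤ 1) →
          ∑ i ∈ Finset.range n, ∑ j ∈ Finset.range m, a i j * T (FourierFactor.trigLp p j) i ≤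
            C * (∑ i ∈ Finset.range (min n m), |a i i| ^ (ENNReal.conjExponent
              (FourierFactor.sExp (ENNReal.conjExponent r) q)).toReal) ^
              (1 / (ENNReal.conjExponent
                (FourierFactor.sExp (ENNReal.conjExponent r) q)).toReal)] ∧
      (ENNReal.conjExponent r ≤ q →
        ((∃ g : FourierFactor.ellp (FourierFactor.sExp (ENNReal.conjExponent r) q),
          ∀ f, T f = FourierFactor.mulOp g (F (FourierFactor.incl hrp f))) ↔
        ∃ C : ℝ, 0 < C ∧ ∀ (n m : ℕ) (a : ℕ → ℝ), (∀ j, |a j| ≤ 1) →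
          ∑ j ∈ Finset.range m, a j * T (FourierFactor.trigLp p j) n ≤
            C * (if n < m then |a n| else 0))) := by
  refine ⟨FourierFactor.fourierOp hr1 hr2, fun f n => rfl, ?_, fun h => ?_⟩
  · have hs := FourierFactor.one_lt_sExp (p := ENNReal.conjExponent r) Fact.out hq
    have hab := FourierFactor.exists_factorization_iff hr1 hr2 hrp hp.ne T
    have hcb := FourierFactor.matrix_domination_iff hs
      fun i j => T (FourierFactor.trigLp p j) i
    tfae_have 1 ↔ 2 := hab
    tfae_have 3 ↔ 2 := hcb
    tfae_finish
  -- For `r' ≤ q` the exponent `s` is `∞`, so (b) asks only for a bounded diagonal, which is what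
  -- the row condition characterizes. With indices from `0`, the case `n ≤ m` of (d) reads `n < m`.
  · rw [FourierFactor.exists_factorization_iff hr1 hr2 hrp hp.ne T,
      FourierFactor.row_domination_iff fun i j => T (FourierFactor.trigLp p j) i,
      show FourierFactor.sExp (ENNReal.conjExponent r) q = ∞ by simp [FourierFactor.sExp, h]]
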